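/- Let $\mathbb{K}$ be $\mathbb{R}$ or $\mathbb{C}$ and let $m\ge 2$ be an integer. For $1\le p<\infty$ and a positive integer $n$, let $\ell_p^n$ be $\mathbb{K}^n$ with the $p$-norm and canonical unit vectors $e_1,\dots,e_n$, and let an $m$-linear form $T:\ell_p^n\times\cdots\times\ell_p^n\to\mathbb{K}$ carry the norm $\|T\|=\sup\{|T(x^{(1)},\dots,x^{(m)})| : \|x^{(k)}\|_p\le 1,\ 1\le k\le m\}$. For real $r\ge 1$, call a real number $s$ an admissible exponent for $(r,p)$ if there is a constant $D>0$ such that $$\Big(\sum_{j_1,\dots,j_m=1}^{n}|T(e_{j_1},\dots,e_{j_m})|^{r}\Big)^{1/r}\le D\,n^{s}\,\|T\|$$ for all positive integers $n$ and all $m$-linear forms $T:\ell_p^n\times\cdots\times\ell_p^n\to\mathbb{K}$. That the optimal exponent of $n$ is not smaller than $s_0$ means that every admissible exponent $s$ satisfies $s\ge s_0$. (a) If $(r,p)\in[1,2]\times[1,2)$, then there is a constant $D>0$ (depending only on $\mathbb{K},m,r,p$) such that $$\Big(\sum_{j_1,\dots,j_m=1}^{n}|T(e_{j_1},\dots,e_{j_m})|^{r}\Big)^{1/r}\le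 D\,n^{\frac{2mr+2mp-mpr-pr}{2pr}}\,\|T\|$$ for all positive integers $n$ and all $m$-linear forms $T:\ell_p^n\times\cdots\times\ell_p^n\to\mathbb{K}$. Moreover, the optimal exponent of $n$ is not smaller than $\frac{2m-r}{2r}$. (b) Let $(r,p)\in(2,\infty)\times[1,m]$. If $p>2$, then there is a constant $D>0$ (depending only on $\mathbb{K},m,r,p$) such that $$\Big(\sum_{j_1,\dots,j_m=1}^{n}|T(e_{j_1},\dots,e_{j_m})|^{r}\Big)^{1/r}\le D\,n^{\frac{2m-p+\varepsilon}{pr}}\,\|T\|$$ for all $\varepsilon>0$, all positive integers $n$ and all $m$-linear forms $T:\ell_p^n\times\cdots\times\ell_p^n\to\mathbb{K}$. If $p=2$, then there is a constant $D>0$ (depending only on $\mathbb{K},m,r$) such that $$\Big(\sum_{j_1,\dots,j_m=1}^{n}|T(e_{j_1},\dots,e_{j_m})|^{r}\Big)^{1/r}\le D\,n^{\frac{2m-p}{pr}}\,\|T\|$$ for all positive integers $n$ and all $m$-linear forms $T:\ell_p^n\times\cdots\times\ell_p^n\to\mathbb{K}$. Moreover, the optimal exponent of $n$ is not smaller than $\frac{2mr+2mp-mpr-pr}{2pr}$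 if $2\le p\le m$, and not smaller than $\frac{2m-r}{2r}$ if $1\le p\le 2$. -/

import Mathlib

open scoped ENNReal

/-- The space `ℓ_p^n` over the scalar field `𝕜`: `𝕜^n` with the `p`-norm. -/
abbrev EllP (𝕜 : Type*) (p : ℝ≥0∞) (n : ℕ) : Type _ :=
  PiLp p (fun _ : Fin n => 𝕜)

/-- The space of `m`-linear forms `T : ℓ_p^n × ⋯ × ℓ_p^n → 𝕜`, normed by
`‖T‖ = sup {|T(x₁, …, xₘ)| : ‖x₁‖, …, ‖xₘ‖ ≤ 1}` (the operator norm). In finite dimension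
every multilinear form is continuous. -/
abbrev EllPForm (𝕜 : Type*) [RCLike 𝕜] (m : ℕ) (p : ℝ≥0∞) [Fact (1 ≤ p)] (n : ℕ) : Type _ :=
  ContinuousMultilinearMap 𝕜 (fun _ : Fin m => EllP 𝕜 p n) 𝕜

/-- `(∑_{j₁, …, jₘ = 1}^n |T(e_{j₁}, …, e_{jₘ})|^r)^{1/r}`, where `e₁, …, eₙ` are the canonical
unit vectors. -/
noncomputable def coeffNorm {𝕜 : Type*} [RCLike 𝕜] {m : ℕ} {p : ℝ≥0∞} [Fact (1 ≤ p)] {n : ℕ}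
    (r : ℝ) (T : EllPForm 𝕜 m p n) : ℝ :=
  (∑ j : Fin m → Fin n, ‖T (fun k => PiLp.single p (j k) (1 : 𝕜))‖ ^ r) ^ (1 / r)

/-- The inequality `(∑ |T(e_{j₁}, …, e_{jₘ})|^r)^{1/r} ≤ D n^s ‖T‖` holds for all positive
integers `n` and all `m`-linear forms `T` on `ℓ_p^n`. -/
def HLBound (𝕜 : Type*) [RCLike 𝕜] (m : ℕ) (r : ℝ) (p : ℝ≥0∞) [Fact (1 ≤ p)] (D s : ℝ) : Prop :=
  ∀ n : ℕ, 0 < n → ∀ T : EllPForm 𝕜 m p n, coeffNorm r T ≤ D * (n : ℝ) ^ s * ‖T‖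

/-- `s` is an exponent of `n` for which the inequality holds with some constant `D > 0` not
depending on `n`. The optimal exponent is the least (more precisely, the infimum) such `s`. -/
def AdmissibleExponent (𝕜 : Type*) [RCLike 𝕜] (m : ℕ) (r : ℝ) (p : ℝ≥0∞) [Fact (1 ≤ p)]
    (s : ℝ) : Prop :=
  ∃ D : ℝ, 0 < D ∧ HLBound 𝕜 m r p D s

/-!
Lower bounds. Random signs produce, for every `n`, an `m`-linear form with coefficients `±1` and
norm of order `√n` on `ℓ₂ⁿ` (`exists_norm_multilinearOfCoeff_le`): a moment generating function
bound controls the form on a finite net of the ball, whose cardinality is exponential in `n`.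
Comparing `ℓ_p` with `ℓ₂`, such a form has norm `O(n ^ (1 / 2 + m σ))` on `ℓ_p`, where `σ = 0` for
`p ≤ 2` and `σ = 1 / 2 - 1 / p` for `p ≥ 2`, while its coefficients have `ℓ_r`-norm `n ^ (m / r)`.
This bounds admissible exponents from below (`AdmissibleExponent.le`).

Upper bounds. For `p ≤ 2` every row of coefficients has `ℓ₂`-norm at most
`n ^ (1 / p - 1 / 2) ‖T‖`, so that the sum of the squares of all coefficients is controlled
(`sum_sq_le_of_le_two`); the power mean inequality passes to `r ≤ 2`, and the bound `‖T‖` for each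
single coefficient passes to `r > 2` (`coeffNorm_le_of_sum_sq_le`). For `2 < p ≤ m` the square sum
of the coefficients is at most `4 ^ m` times the squared norm of the form on `ℓ_{2m}`
(`sum_norm_sq_le_of_coeffForm_le`, a Hardy–Littlewood inequality deduced from Khinchine's), and
comparing `ℓ_p` with `ℓ_{2m}` costs the factor `n ^ (2m / p - 1)`. The resulting constant works with
`ε = 0`, hence for all `ε > 0`.
-/

/-! ### Khinchine's inequality -/

theorem Fin.sum_pi_succ {M α : Type*} [AddCommMonoid M] [Fintype α] (n : ℕ)
    (F : (Fin (n + 1) → α) → M) :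
    ∑ f, F f = ∑ a, ∑ g : Fin n → α, F (Fin.cons a g) := by
  rw [← (Fin.consEquiv fun _ : Fin (n + 1) => α).sum_comp, Fintype.sum_prod_type]
  rfl

theorem Int.sum_units {M : Type*} [AddCommMonoid M] (F : ℤˣ → M) : ∑ u, F u = F 1 + F (-1) := by
  rw [show (Finset.univ : Finset ℤˣ) = {1, -1} from rfl, Finset.sum_pair (by decide)]

/-- The signed sum `∑ ε_j v_j`. -/
def signSum {H : Type*} [AddCommGroup H] {n : ℕ} (v : Fin n → H) (ε : Fin n → ℤˣ) : H :=
  ∑ j, (ε j : ℤ) • v j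

theorem signSum_cons {H : Type*} [AddCommGroup H] {n : ℕ} (v : Fin (n + 1) → H) (u : ℤˣ)
    (ε : Fin n → ℤˣ) :
    signSum v (Fin.cons u ε) = signSum (fun j => v j.succ) ε + (u : ℤ) • v 0 := by
  simp [signSum, Fin.sum_univ_succ, add_comm]

theorem sum_norm_signSum_sq (𝕜 : Type*) {H : Type*} [RCLike 𝕜] [NormedAddCommGroup H]
    [InnerProductSpace 𝕜 H] {n : ℕ} (v : Fin n → H) :
    ∑ ε, ‖signSum v ε‖ ^ 2 = 2 ^ n * ∑ j, ‖v j‖ ^ 2 := by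
  induction n with
  | zero => simp [signSum]
  | succ n ih =>
    rw [Fin.sum_pi_succ, Int.sum_units, Fin.sum_univ_succ, ← Finset.sum_add_distrib]
    have key (x : H) : ‖x + v 0‖ ^ 2 + ‖x - v 0‖ ^ 2 = 2 * ‖x‖ ^ 2 + 2 * ‖v 0‖ ^ 2 := by
      have := parallelogram_law_with_norm 𝕜 x (v 0)
      linarith
    simp only [signSum_cons, Units.val_one, one_smul, Units.val_neg, neg_smul, ← sub_eq_add_neg,
      key, Finset.sum_add_distrib, ← Finset.mul_sum, ih]
    simp
    ring

theorem norm_add_pow_four_add_norm_sub_pow_four_le (𝕜 : Type*) {H : Type*} [RCLike 𝕜]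
    [NormedAddCommGroup H] [InnerProductSpace 𝕜 H] (x y : H) :
    ‖x + y‖ ^ 4 + ‖x - y‖ ^ 4 ≤ 2 * ‖x‖ ^ 4 + 12 * (‖x‖ ^ 2 * ‖y‖ ^ 2) + 2 * ‖y‖ ^ 4 := by
  have h1 := @norm_add_sq 𝕜 _ _ _ _ x y
  have h2 := @norm_sub_sq 𝕜 _ _ _ _ x y
  have h3 : RCLike.re (inner 𝕜 x y) ^ 2 ≤ ‖x‖ ^ 2 * ‖y‖ ^ 2 := by
    rw [← mul_pow]
    exact sq_le_sq' (by linarith [neg_abs_le (RCLike.re (inner 𝕜 x y)),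
      (RCLike.abs_re_le_norm _).trans (norm_inner_le_norm (𝕜 := 𝕜) x y)])
      ((le_abs_self _).trans ((RCLike.abs_re_le_norm _).trans (norm_inner_le_norm x y)))
  calc ‖x + y‖ ^ 4 + ‖x - y‖ ^ 4 = (‖x + y‖ ^ 2) ^ 2 + (‖x - y‖ ^ 2) ^ 2 := by ring
    _ = 2 * (‖x‖ ^ 2 + ‖y‖ ^ 2) ^ 2 + 8 * RCLike.re (inner 𝕜 x y) ^ 2 := by rw [h1, h2]; ring
    _ ≤ 2 * (‖x‖ ^ 2 + ‖y‖ ^ 2) ^ 2 + 8 * (‖x‖ ^ 2 * ‖y‖ ^ 2) := by linarith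
    _ = _ := by ring

theorem sum_norm_signSum_pow_four_le (𝕜 : Type*) {H : Type*} [RCLike 𝕜] [NormedAddCommGroup H]
    [InnerProductSpace 𝕜 H] {n : ℕ} (v : Fin n → H) :
    ∑ ε, ‖signSum v ε‖ ^ 4 ≤ 2 ^ n * (3 * (∑ j, ‖v j‖ ^ 2) ^ 2) := by
  induction n with
  | zero => simp [signSum]
  | succ n ih =>
    rw [Fin.sum_pi_succ, Int.sum_units, Fin.sum_univ_succ, ← Finset.sum_add_distrib]
    simp only [signSum_cons, Units.val_one, one_smul, Units.val_neg, neg_smul, ← sub_eq_add_neg]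
    refine (Finset.sum_le_sum fun ε _ =>
      norm_add_pow_four_add_norm_sub_pow_four_le 𝕜 _ _).trans ?_
    simp only [Finset.sum_add_distrib, ← Finset.mul_sum, ← Finset.sum_mul,
      sum_norm_signSum_sq 𝕜]
    have h := ih fun j => v j.succ
    simp only [Finset.sum_const, Finset.card_univ, Fintype.card_pi, Fintype.card_units_int,
      Finset.prod_const, Fintype.card_fin, nsmul_eq_mul]
    push_cast
    set s := ∑ j : Fin n, ‖v j.succ‖ ^ 2
    have : 0 ≤ (2 : ℝ) ^ n * ‖v 0‖ ^ 4 := by positivity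
    calc _ ≤ 2 * (2 ^ n * (3 * s ^ 2)) + 12 * (2 ^ n * s * ‖v 0‖ ^ 2) +
          2 * (2 ^ n * ‖v 0‖ ^ 4) := by gcongr
      _ ≤ _ := by rw [pow_succ (2 : ℝ) n]; linear_combination 4 * this

/-- Khinchine's inequality for vectors of a Hilbert space: the first moment of a signed sum controls
the second, because the fourth is at most three times the square of the second. The sums over `ε`
are `2 ^ n` times the averages. -/
theorem sqrt_sum_norm_sq_le_sum_norm_signSum (𝕜 : Type*) {H : Type*} [RCLike 𝕜]
    [NormedAddCommGroup H] [InnerProductSpace 𝕜 H] {n : ℕ} (v : Fin n → H) :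
    2 ^ n * √(∑ j, ‖v j‖ ^ 2) ≤ 2 * ∑ ε, ‖signSum v ε‖ := by
  set s := ∑ j, ‖v j‖ ^ 2 with hs
  have hs0 : 0 ≤ s := Finset.sum_nonneg fun _ _ => by positivity
  rcases hs0.eq_or_lt with h0 | hpos
  · rw [← h0]; simp only [Real.sqrt_zero, mul_zero]; positivity
  set σ := √s
  have hσ : 0 < σ := Real.sqrt_pos.2 hpos
  have hσ2 : σ ^ 2 = s := Real.sq_sqrt hs0
  -- `u ≥ u ^ 2 - u ^ 4 / 6` for `u ≥ 0`, applied to `u = x / σ`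
  have key (x : ℝ) (hx : 0 ≤ x) : 6 * σ ^ 2 * x ^ 2 - x ^ 4 ≤ 6 * σ ^ 3 * x := by
    have h' : x ^ 3 + 6 * σ ^ 3 - 6 * σ ^ 2 * x ≥ 0 := by
      nlinarith [mul_nonneg (sq_nonneg (x - 3 / 2 * σ)) (by positivity : 0 ≤ x + 3 * σ),
        pow_pos hσ 3, mul_nonneg hx (sq_nonneg σ), pow_nonneg hx 3,
        mul_nonneg (sq_nonneg (x - 7 / 5 * σ)) (by positivity : 0 ≤ x + 14 / 5 * σ)]
    nlinarith [mul_nonneg hx h']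
  have hsum : ∑ ε, (6 * σ ^ 2 * ‖signSum v ε‖ ^ 2 - ‖signSum v ε‖ ^ 4) ≤
      ∑ ε, 6 * σ ^ 3 * ‖signSum v ε‖ := Finset.sum_le_sum fun ε _ => key _ (norm_nonneg _)
  rw [Finset.sum_sub_distrib, ← Finset.mul_sum, ← Finset.mul_sum,
    sum_norm_signSum_sq 𝕜] at hsum
  have h4 := sum_norm_signSum_pow_four_le 𝕜 v
  rw [← hs, ← hσ2] at *
  have : σ ^ 3 * (2 ^ n * σ) ≤ σ ^ 3 * (2 * ∑ ε, ‖signSum v ε‖) := by nlinarith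
  exact le_of_mul_le_mul_left this (by positivity)

/-- The form `∑_j a_j x₁(j₁) ⋯ xₘ(jₘ)` with coefficients `a`. -/
def coeffForm {𝕜 : Type*} [CommSemiring 𝕜] {m n : ℕ} (a : (Fin m → Fin n) → 𝕜)
    (x : Fin m → Fin n → 𝕜) : 𝕜 :=
  ∑ j, a j * ∏ k, x k (j k)

/-- Khinchine's inequality for multilinear forms in independent signs: iterate the Hilbert space
valued inequality, one variable at a time. -/
theorem sqrt_sum_norm_sq_le_sum_norm_coeffForm {𝕜 : Type*} [RCLike 𝕜] {m n : ℕ}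
    (a : (Fin m → Fin n) → 𝕜) :
    (2 ^ n) ^ m * √(∑ j, ‖a j‖ ^ 2) ≤
      2 ^ m * ∑ ε : Fin m → Fin n → ℤˣ, ‖coeffForm a fun k i => ((ε k i : ℤ) : 𝕜)‖ := by
  induction m with
  | zero => simp [coeffForm]
  | succ m ih =>
    let v : Fin n → EuclideanSpace 𝕜 (Fin m → Fin n) :=
      fun i => WithLp.toLp 2 fun j => a (Fin.cons i j)
    have h1 : ∑ j, ‖a j‖ ^ 2 = ∑ i, ‖v i‖ ^ 2 := by
      rw [Fin.sum_pi_succ]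
      simp [v, EuclideanSpace.norm_sq_eq]
    have h2 (u : Fin n → ℤˣ) :
        (2 ^ n) ^ m * ‖signSum v u‖ ≤ 2 ^ m * ∑ ε : Fin m → Fin n → ℤˣ,
          ‖coeffForm a fun k i => ((Fin.cons u ε : Fin (m + 1) → Fin n → ℤˣ) k i : 𝕜)‖ := by
      have := ih fun j => signSum v u j
      rw [← EuclideanSpace.norm_eq] at this
      refine this.trans_eq ?_
      congr 1
      refine Finset.sum_congr rfl fun ε _ => ?_
      congr 1
      simp only [coeffForm]
      rw [Fin.sum_pi_succ, Finset.sum_comm]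
      refine Finset.sum_congr rfl fun j _ => ?_
      simp [signSum, v, Fin.prod_univ_succ, Finset.sum_mul]
      refine Finset.sum_congr rfl fun i _ => ?_
      ring
    calc (2 ^ n) ^ (m + 1) * √(∑ j, ‖a j‖ ^ 2)
        = (2 ^ n) ^ m * (2 ^ n * √(∑ i, ‖v i‖ ^ 2)) := by rw [h1]; ring
      _ ≤ (2 ^ n) ^ m * (2 * ∑ u, ‖signSum v u‖) := by
          exact mul_le_mul_of_nonneg_left (sqrt_sum_norm_sq_le_sum_norm_signSum 𝕜 v) (by positivity)
      _ = 2 * ∑ u, (2 ^ n) ^ m * ‖signSum v u‖ := by rw [← Finset.mul_sum]; ring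
      _ ≤ 2 * ∑ u : Fin n → ℤˣ, 2 ^ m * ∑ ε : Fin m → Fin n → ℤˣ,
          ‖coeffForm a fun k i => ((Fin.cons u ε : Fin (m + 1) → Fin n → ℤˣ) k i : 𝕜)‖ := by
          exact mul_le_mul_of_nonneg_left (Finset.sum_le_sum fun u _ => h2 u) zero_le_two
      _ = _ := by rw [Fin.sum_pi_succ, ← Finset.mul_sum]; ring

/-! ### The Hardy–Littlewood inequality on `ℓ_{2m}` -/

/-- Littlewood's mixed `(ℓ₁, ℓ₂)`-inequality, with weights `y`: for each coordinate `k`, the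
`ℓ₁`-sum over `jₖ` of the `ℓ₂`-norms over the other indices is controlled by the form. -/
theorem sum_sqrt_le_of_coeffForm_le {𝕜 : Type*} [RCLike 𝕜] {m n : ℕ} (a : (Fin m → Fin n) → 𝕜)
    (y : Fin m → Fin n → ℝ) (hy : ∀ l i, 0 ≤ y l i) (M : ℝ)
    (hM : ∀ x : Fin m → Fin n → 𝕜, (∀ l i, ‖x l i‖ = y l i) → ‖coeffForm a x‖ ≤ M) (k : Fin m) :
    ∑ i, √(∑ j with j k = i, ‖a j‖ ^ 2 * (∏ l, y l (j l)) ^ 2) ≤ 2 ^ m * M := by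
  let b (i : Fin n) (j : Fin m → Fin n) : 𝕜 :=
    if j k = i then a j * ((∏ l, y l (j l) : ℝ) : 𝕜) else 0
  let e (ε : Fin m → Fin n → ℤˣ) : Fin m → Fin n → 𝕜 := fun l i => ((ε l i : ℤ) : 𝕜)
  have hε (u : ℤˣ) : ‖((u : ℤ) : 𝕜)‖ = 1 := by
    rcases Int.units_eq_one_or u with rfl | rfl <;> simp
  have hb (i : Fin n) : ∑ j with j k = i, ‖a j‖ ^ 2 * (∏ l, y l (j l)) ^ 2 = ∑ j, ‖b i j‖ ^ 2 := by
    rw [Finset.sum_filter]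
    refine Finset.sum_congr rfl fun j _ => ?_
    by_cases h : j k = i
    · simp [b, h, mul_pow, ← Finset.prod_pow]
    · simp [b, h]
  have hX (ε : Fin m → Fin n → ℤˣ) : ∑ i, ‖coeffForm (b i) (e ε)‖ ≤ M := by
    choose θ hθ hθ' using fun i => RCLike.exists_norm_eq_mul_self (coeffForm (b i) (e ε))
    let x : Fin m → Fin n → 𝕜 := fun l i => y l i * (e ε l i * if l = k then θ i else 1)
    have hx : ∀ l i, ‖x l i‖ = y l i := by
      intro l i
      by_cases h : l = k <;> simp [x, e, h, hε, hθ, hy]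
    have h1 : ((∑ i, ‖coeffForm (b i) (e ε)‖ : ℝ) : 𝕜) = coeffForm a x := by
      push_cast
      rw [Finset.sum_congr rfl fun i _ => hθ' i]
      simp only [coeffForm, Finset.mul_sum]
      rw [Finset.sum_comm]
      refine Finset.sum_congr rfl fun j _ => ?_
      have h3 : ∏ l, x l (j l) = ((∏ l, y l (j l) : ℝ) : 𝕜) * ((∏ l, e ε l (j l)) * θ (j k)) := by
        simp only [x, Finset.prod_mul_distrib]
        rw [Finset.prod_ite_eq' Finset.univ k fun l => θ (j l)]
        simp
      rw [h3]
      simp only [b, ite_mul, mul_ite, mul_zero, zero_mul, Finset.sum_ite_eq, Finset.mem_univ,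
        if_true]
      ring
    have h2 := hM x hx
    rw [← h1, RCLike.norm_ofReal] at h2
    exact (le_abs_self _).trans h2
  have hcard : (Fintype.card (Fin m → Fin n → ℤˣ) : ℝ) = (2 ^ n) ^ m := by simp
  have hpos : (0 : ℝ) < (2 ^ n) ^ m := by positivity
  refine le_of_mul_le_mul_left ?_ hpos
  calc (2 ^ n) ^ m * ∑ i, √(∑ j with j k = i, ‖a j‖ ^ 2 * (∏ l, y l (j l)) ^ 2)
      = ∑ i, (2 ^ n) ^ m * √(∑ j, ‖b i j‖ ^ 2) := by simp only [hb, Finset.mul_sum]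
    _ ≤ ∑ i, 2 ^ m * ∑ ε, ‖coeffForm (b i) (e ε)‖ :=
        Finset.sum_le_sum fun i _ => sqrt_sum_norm_sq_le_sum_norm_coeffForm (b i)
    _ = 2 ^ m * ∑ ε, ∑ i, ‖coeffForm (b i) (e ε)‖ := by rw [← Finset.mul_sum, Finset.sum_comm]
    _ ≤ 2 ^ m * ∑ ε : Fin m → Fin n → ℤˣ, M :=
        mul_le_mul_of_nonneg_left (Finset.sum_le_sum fun ε _ => hX ε) (by positivity)
    _ = _ := by
        rw [Finset.sum_const, Finset.card_univ, nsmul_eq_mul, hcard]; ring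

/-- The Hardy–Littlewood inequality in the critical case: the coefficients of an `m`-linear form
on `ℓ_{2m}` are square summable, with a bound independent of the dimension. Littlewood's mixed
inequality is applied with the weights `yₗ(i) = (Rₗ(i) / Σ) ^ (1 / 2m)`, where `Σ = ∑ |a_j|²` and
`Rₗ(i)` is the part of this sum with `jₗ = i`; averaging over the distinguished coordinate `k` by
the inequality between the arithmetic and the geometric mean removes all weights. -/
theorem sum_norm_sq_le_of_coeffForm_le {𝕜 : Type*} [RCLike 𝕜] {m n : ℕ} (hm : 0 < m)
    (a : (Fin m → Fin n) → 𝕜) (M : ℝ)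
    (hM : ∀ x : Fin m → Fin n → 𝕜, (∀ l, ∑ i, ‖x l i‖ ^ (2 * m) ≤ 1) → ‖coeffForm a x‖ ≤ M) :
    ∑ j, ‖a j‖ ^ 2 ≤ 4 ^ m * M ^ 2 := by
  set S := ∑ j, ‖a j‖ ^ 2 with hS
  have hS0 : 0 ≤ S := Finset.sum_nonneg fun _ _ => by positivity
  rcases hS0.eq_or_lt with h0 | hSpos
  · rw [← h0]; positivity
  have hm' : (0 : ℝ) < m := by exact_mod_cast hm
  let R (l : Fin m) (i : Fin n) : ℝ := ∑ j with j l = i, ‖a j‖ ^ 2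
  have hR0 (l i) : 0 ≤ R l i := Finset.sum_nonneg fun _ _ => by positivity
  have hRS (l) : ∑ i, R l i = S := Finset.sum_fiberwise _ _ _
  have hRj (l) (j : Fin m → Fin n) : ‖a j‖ ^ 2 ≤ R l (j l) :=
    Finset.single_le_sum (f := fun j => ‖a j‖ ^ 2) (fun _ _ => by positivity) (by simp)
  let y (l : Fin m) (i : Fin n) : ℝ := (R l i / S) ^ ((1 : ℝ) / (2 * m))
  have hy0 (l i) : 0 ≤ y l i := Real.rpow_nonneg (div_nonneg (hR0 l i) hS0) _
  have hy (l i) : y l i ^ (2 * m) = R l i / S := by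
    simp only [y]
    rw [← Real.rpow_natCast, ← Real.rpow_mul (div_nonneg (hR0 l i) hS0)]
    have : (1 : ℝ) / (2 * m) * (2 * m : ℕ) = 1 := by push_cast; field_simp
    rw [this, Real.rpow_one]
  let P (j : Fin m → Fin n) : ℝ := ∏ l, y l (j l)
  have hP0 (j) : 0 ≤ P j := Finset.prod_nonneg fun l _ => hy0 l (j l)
  have hL (k : Fin m) : ∑ j, ‖a j‖ ^ 2 * (P j / √(R k (j k))) ≤ 2 ^ m * M := by
    refine le_trans ?_ (sum_sqrt_le_of_coeffForm_le a y hy0 M (fun x hx => hM x fun l => ?_) k)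
    · rw [← Finset.sum_fiberwise Finset.univ (fun j => j k)]
      refine Finset.sum_le_sum fun i _ => ?_
      calc ∑ j with j k = i, ‖a j‖ ^ 2 * (P j / √(R k (j k)))
          = (∑ j with j k = i, ‖a j‖ * (‖a j‖ * P j)) / √(R k i) := by
            rw [Finset.sum_div]
            refine Finset.sum_congr rfl fun j hj => ?_
            rw [(Finset.mem_filter.1 hj).2]; ring
        _ ≤ (√(R k i) * √(∑ j with j k = i, (‖a j‖ * P j) ^ 2)) / √(R k i) := by
            gcongr
            exact Real.sum_mul_le_sqrt_mul_sqrt _ _ _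
        _ ≤ √(∑ j with j k = i, (‖a j‖ * P j) ^ 2) := by
            rw [mul_div_right_comm]
            exact mul_le_of_le_one_left (Real.sqrt_nonneg _) (div_self_le_one _)
        _ = _ := by simp only [mul_pow, P]
    · simp only [hx, hy, ← Finset.sum_div, hRS, div_self hSpos.ne', le_refl]
  -- the inequality between the means, in the form `t - 1 ≥ log t`
  have hAG (j) : m * ‖a j‖ ^ 2 ≤ √S * ∑ k, ‖a j‖ ^ 2 * (P j / √(R k (j k))) := by
    by_cases ha : a j = 0
    · simp [ha]
    have hRpos (k) : 0 < R k (j k) := lt_of_lt_of_le (by positivity) (hRj k j)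
    have hypos (k) : 0 < y k (j k) := Real.rpow_pos_of_pos (div_pos (hRpos k) hSpos) _
    have hPpos : 0 < P j := Finset.prod_pos fun k _ => hypos k
    have hlogP : m * Real.log (√S * P j) = ∑ k, Real.log √(R k (j k)) := by
      rw [Real.log_mul (by positivity) hPpos.ne', Real.log_prod fun k _ => (hypos k).ne']
      simp only [y, Real.log_rpow (div_pos (hRpos _) hSpos), Real.log_div (hRpos _).ne' hSpos.ne',
        Real.log_sqrt hS0, Real.log_sqrt (hR0 _ _), ← Finset.mul_sum, Finset.sum_sub_distrib,
        ← Finset.sum_div, Finset.sum_const, Finset.card_univ, Fintype.card_fin, nsmul_eq_mul]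
      field_simp
      ring
    have hge : (m : ℝ) ≤ ∑ k, √S * P j / √(R k (j k)) := by
      have h1 (k) : 1 + (Real.log (√S * P j) - Real.log √(R k (j k))) ≤
          √S * P j / √(R k (j k)) := by
        rw [← Real.log_div (by positivity) (Real.sqrt_pos.2 (hRpos k)).ne']
        have := Real.log_le_sub_one_of_pos (x := √S * P j / √(R k (j k)))
          (div_pos (by positivity) (Real.sqrt_pos.2 (hRpos k)))
        linarith
      refine le_trans (le_of_eq ?_) (Finset.sum_le_sum fun k _ => h1 k)
      rw [Finset.sum_add_distrib, Finset.sum_sub_distrib, ← hlogP]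
      simp
    calc m * ‖a j‖ ^ 2 ≤ (∑ k, √S * P j / √(R k (j k))) * ‖a j‖ ^ 2 := by gcongr
      _ = _ := by
        rw [Finset.sum_mul, Finset.mul_sum]
        exact Finset.sum_congr rfl fun k _ => by ring
  have hfin : m * (√S * √S) ≤ m * (√S * (2 ^ m * M)) := by
    calc m * (√S * √S) = ∑ j, m * ‖a j‖ ^ 2 := by
          rw [Real.mul_self_sqrt hS0, hS, Finset.mul_sum]
      _ ≤ ∑ j, √S * ∑ k, ‖a j‖ ^ 2 * (P j / √(R k (j k))) := Finset.sum_le_sum fun j _ => hAG j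
      _ = √S * ∑ k, ∑ j, ‖a j‖ ^ 2 * (P j / √(R k (j k))) := by
          rw [← Finset.mul_sum, Finset.sum_comm]
      _ ≤ √S * ∑ k : Fin m, 2 ^ m * M :=
          mul_le_mul_of_nonneg_left (Finset.sum_le_sum fun k _ => hL k) (Real.sqrt_nonneg _)
      _ = _ := by simp; ring
  have hs : √S ≤ 2 ^ m * M :=
    le_of_mul_le_mul_left (le_of_mul_le_mul_left hfin hm') (Real.sqrt_pos.2 hSpos)
  calc S = √S ^ 2 := (Real.sq_sqrt hS0).symm
    _ ≤ (2 ^ m * M) ^ 2 := by gcongr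
    _ = _ := by rw [mul_pow, ← pow_mul, mul_comm m 2, pow_mul]; norm_num

/-! ### Forms with random signs -/

/-- The probabilistic method: the moment generating function of `∑ ε_j a_j` at `t`
is at most `exp (t ^ 2 / 2)` if `∑ a_j ^ 2 ≤ 1`, so that some signs keep the absolute values of the
sums below `2 t` for all members of a family of size at most `exp (t ^ 2) / 2`. -/
theorem exists_signs_abs_sum_le {J Γ : Type*} [Fintype J] [DecidableEq J] [Fintype Γ]
    (a : Γ → J → ℝ) (ha : ∀ γ, ∑ j, a γ j ^ 2 ≤ 1) (t : ℝ) (ht : 0 < t)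
    (hΓ : 2 * (Fintype.card Γ : ℝ) ≤ Real.exp (t ^ 2)) :
    ∃ ε : J → ℤˣ, ∀ γ, |∑ j, (ε j : ℤ) * a γ j| ≤ 2 * t := by
  have hmgf (b : J → ℝ) (hb : ∑ j, b j ^ 2 ≤ 1) :
      ∑ ε : J → ℤˣ, Real.exp (∑ j, (ε j : ℤ) * (t * b j)) ≤ 2 ^ Fintype.card J * Real.exp (t ^ 2 / 2) := by
    have h1 : ∑ ε : J → ℤˣ, Real.exp (∑ j, (ε j : ℤ) * (t * b j)) =
        ∏ j, ∑ u : ℤˣ, Real.exp ((u : ℤ) * (t * b j)) := by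
      rw [Finset.prod_univ_sum, Fintype.piFinset_univ]
      exact Finset.sum_congr rfl fun ε _ => Real.exp_sum _ _
    have h2 (j) : ∑ u : ℤˣ, Real.exp ((u : ℤ) * (t * b j)) ≤
        2 * Real.exp ((t * b j) ^ 2 / 2) := by
      have := Real.cosh_le_exp_half_sq (t * b j)
      rw [Real.cosh_eq] at this
      rw [Int.sum_units]
      simp only [Units.val_one, Units.val_neg, Int.cast_one, Int.cast_neg, one_mul, neg_mul]
      linarith
    rw [h1]
    refine (Finset.prod_le_prod (fun j _ => Finset.sum_nonneg fun _ _ => (Real.exp_pos _).le)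
      fun j _ => h2 j).trans ?_
    rw [Finset.prod_mul_distrib, ← Real.exp_sum, Finset.prod_const, Finset.card_univ]
    gcongr
    rw [← Finset.sum_div]
    simp only [mul_pow, ← Finset.mul_sum]
    nlinarith [sq_nonneg t]
  let F (ε : J → ℤˣ) (γ : Γ) : ℝ := Real.exp (∑ j, (ε j : ℤ) * (t * a γ j)) +
    Real.exp (∑ j, (ε j : ℤ) * (t * -a γ j))
  have havg : ∑ ε : J → ℤˣ, ∑ γ, F ε γ ≤ ∑ ε : J → ℤˣ, Real.exp (t ^ 2) * Real.exp (t ^ 2 / 2) := by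
    rw [Finset.sum_comm]
    calc ∑ γ, ∑ ε, F ε γ ≤ ∑ γ : Γ, 2 * (2 ^ Fintype.card J * Real.exp (t ^ 2 / 2)) := by
          refine Finset.sum_le_sum fun γ _ => ?_
          have h1 := hmgf (a γ) (ha γ)
          have h2 := hmgf (fun j => -a γ j) (by simpa using ha γ)
          simp only [F]
          rw [Finset.sum_add_distrib]
          linarith
      _ = 2 * (Fintype.card Γ : ℝ) * (2 ^ Fintype.card J * Real.exp (t ^ 2 / 2)) := by
          rw [Finset.sum_const, Finset.card_univ, nsmul_eq_mul]; ring
      _ ≤ Real.exp (t ^ 2) * (2 ^ Fintype.card J * Real.exp (t ^ 2 / 2)) := by gcongr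
      _ = _ := by
          rw [Finset.sum_const, Finset.card_univ, nsmul_eq_mul, Fintype.card_fun,
            Fintype.card_units_int]
          push_cast; ring
  obtain ⟨ε, -, hε⟩ := Finset.exists_le_of_sum_le Finset.univ_nonempty havg
  refine ⟨ε, fun γ => ?_⟩
  have hγ : F ε γ ≤ Real.exp (t ^ 2 + t ^ 2 / 2) := by
    rw [Real.exp_add]
    exact (Finset.single_le_sum (f := F ε) (fun γ _ => by positivity) (Finset.mem_univ γ)).trans hε
  have hp := Real.exp_pos (∑ j, (ε j : ℤ) * (t * a γ j))
  have hn := Real.exp_pos (∑ j, (ε j : ℤ) * (t * -a γ j))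
  have h1 := Real.exp_le_exp.1 ((by linarith : _ ≤ F ε γ).trans hγ :
    Real.exp (∑ j, (ε j : ℤ) * (t * a γ j)) ≤ _)
  have h2 := Real.exp_le_exp.1 ((by linarith : _ ≤ F ε γ).trans hγ :
    Real.exp (∑ j, (ε j : ℤ) * (t * -a γ j)) ≤ _)
  have e1 : ∑ j, (ε j : ℤ) * (t * a γ j) = t * ∑ j, (ε j : ℤ) * a γ j := by
    rw [Finset.mul_sum]; exact Finset.sum_congr rfl fun j _ => by ring
  have e2 : ∑ j, (ε j : ℤ) * (t * -a γ j) = -(t * ∑ j, (ε j : ℤ) * a γ j) := by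
    rw [Finset.mul_sum, ← Finset.sum_neg_distrib]; exact Finset.sum_congr rfl fun j _ => by ring
  rw [e1] at h1
  rw [e2] at h2
  rw [abs_le]
  constructor <;> nlinarith

/-! ### A net of the Euclidean ball -/

/-- The `ℓ₁`-ball of radius `N` contains at most exponentially many points with natural coordinates:
give the point `c` the weight `2 ^ (N - ∑ c i) ≥ 1` and sum geometric series. -/
theorem card_sum_le_le (ι : Type*) [Fintype ι] [DecidableEq ι] (N : ℕ) :
    ((Fintype.piFinset fun _ : ι => Finset.range (N + 1)).filter fun c => ∑ i, c i ≤ N).card ≤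
      2 ^ (N + Fintype.card ι) := by
  have key : ((((Fintype.piFinset fun _ : ι => Finset.range (N + 1)).filter
      fun c => ∑ i, c i ≤ N).card : ℕ) : ℝ) ≤ 2 ^ (N + Fintype.card ι) := by
    rw [Finset.card_eq_sum_ones, Nat.cast_sum]
    calc ∑ c ∈ (Fintype.piFinset fun _ : ι => Finset.range (N + 1)).filter fun c => ∑ i, c i ≤ N,
          ((1 : ℕ) : ℝ)
        ≤ ∑ c ∈ (Fintype.piFinset fun _ : ι => Finset.range (N + 1)).filter fun c => ∑ i, c i ≤ N,
          2 ^ N * ∏ i, (1 / 2 : ℝ) ^ c i := by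
          refine Finset.sum_le_sum fun c hc => ?_
          rw [Finset.prod_pow_eq_pow_sum, one_div, inv_pow, ← div_eq_mul_inv, Nat.cast_one,
            one_le_div (by positivity)]
          exact pow_le_pow_right₀ one_le_two (Finset.mem_filter.1 hc).2
      _ ≤ ∑ c ∈ Fintype.piFinset fun _ : ι => Finset.range (N + 1),
          2 ^ N * ∏ i, (1 / 2 : ℝ) ^ c i :=
          Finset.sum_le_sum_of_subset_of_nonneg (Finset.filter_subset _ _)
            fun _ _ _ => by positivity
      _ = 2 ^ N * ∏ _i : ι, ∑ k ∈ Finset.range (N + 1), (1 / 2 : ℝ) ^ k := by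
          rw [Finset.prod_univ_sum, Finset.mul_sum]
      _ ≤ 2 ^ N * ∏ _i : ι, 2 := by
          gcongr
          exact sum_geometric_two_le _
      _ = 2 ^ (N + Fintype.card ι) := by
          rw [Finset.prod_const, Finset.card_univ, pow_add]
  exact_mod_cast key

/-- Rounding towards zero: the integer part `b - c` of `t`, where one of `b`, `c` vanishes, so
that `b + c = |b - c|` is an integer in `[0, |t|]` and hence at most `t ^ 2`. -/
theorem Real.exists_nat_sub_nat_approx (t : ℝ) :
    ∃ b c : ℕ, |t - (b - c)| ≤ 1 ∧ |(b : ℝ) - c| ≤ |t| ∧ (b + c : ℝ) ≤ t ^ 2 := by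
  have key (t : ℝ) (ht : 0 ≤ t) : |t - ⌊t⌋₊| ≤ 1 ∧ (⌊t⌋₊ : ℝ) ≤ t ∧ (⌊t⌋₊ : ℝ) ≤ t ^ 2 := by
    have h1 := Nat.floor_le ht
    have h2 := Nat.lt_floor_add_one t
    refine ⟨by rw [abs_le]; constructor <;> linarith, h1, ?_⟩
    have h3 : (⌊t⌋₊ : ℝ) ≤ (⌊t⌋₊ : ℝ) ^ 2 := by exact_mod_cast Nat.le_self_pow two_ne_zero _
    exact h3.trans (by gcongr)
  rcases le_total 0 t with ht | ht
  · obtain ⟨h1, h2, h3⟩ := key t ht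
    exact ⟨⌊t⌋₊, 0, by simpa using h1, by simpa [abs_of_nonneg ht] using h2, by simpa using h3⟩
  · obtain ⟨h1, h2, h3⟩ := key (-t) (by linarith)
    refine ⟨0, ⌊-t⌋₊, ?_, by simpa [abs_of_nonpos ht] using h2, by simpa using h3⟩
    rw [← abs_neg]
    convert h1 using 2
    push_cast; ring

theorem RCLike.norm_ofReal_add_ofReal_mul_I_sq_le {𝕜 : Type*} [RCLike 𝕜] (u v : ℝ) :
    ‖(u : 𝕜) + (v : 𝕜) * RCLike.I‖ ^ 2 ≤ u ^ 2 + v ^ 2 := by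
  rw [← RCLike.normSq_eq_def', RCLike.normSq_apply]
  rcases RCLike.I_eq_zero_or_im_I_eq_one (K := 𝕜) with h | h
  · simp [h]; nlinarith [sq_nonneg v]
  · simp [h]; nlinarith

theorem RCLike.norm_le_abs_re_add_abs_im {𝕜 : Type*} [RCLike 𝕜] (z : 𝕜) :
    ‖z‖ ≤ |RCLike.re z| + |RCLike.im z| := by
  refine abs_le_of_sq_le_sq' ?_ (by positivity) |>.2
  rw [← RCLike.normSq_eq_def', RCLike.normSq_apply, add_sq, sq_abs, sq_abs]
  nlinarith [mul_nonneg (abs_nonneg (RCLike.re z)) (abs_nonneg (RCLike.im z))]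

/-- A finite set of vectors of exponential size that is a net of the unit ball of `ℓ₂ⁿ`: the
points in this ball of a lattice of mesh `1 / (2 K √n)`. Real and imaginary parts are differences of
natural numbers, so a lattice point is encoded by `4n` natural numbers, and integrality turns the
`ℓ₂`-bound into an `ℓ₁`-bound for them. -/
theorem exists_net (𝕜 : Type*) [RCLike 𝕜] (n K : ℕ) (hn : 0 < n) (hK : 0 < K) :
    ∃ S : Finset (EllP 𝕜 2 n), S.card ≤ 2 ^ ((4 * K ^ 2 + 4) * n) ∧ (∀ s ∈ S, ‖s‖ ≤ 1) ∧
      ∀ x : EllP 𝕜 2 n, ‖x‖ ≤ 1 → ∃ s ∈ S, ‖x - s‖ ≤ 1 / K := by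
  classical
  have hn' : (0 : ℝ) < n := by exact_mod_cast hn
  have hK' : (0 : ℝ) < K := by exact_mod_cast hK
  set N := 4 * K ^ 2 * n with hN
  set h : ℝ := 1 / (2 * K * √n) with hh
  have hhpos : 0 < h := by positivity
  have hNh : (N : ℝ) * h ^ 2 = 1 := by
    rw [hh, div_pow, mul_pow, mul_pow, Real.sq_sqrt hn'.le, hN]
    push_cast; field_simp; norm_num
  let f (c : Fin n × Fin 4 → ℕ) : EllP 𝕜 2 n := WithLp.toLp 2 fun i =>
    ((h * ((c (i, 0) : ℝ) - c (i, 1)) : ℝ) : 𝕜) +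
      ((h * ((c (i, 2) : ℝ) - c (i, 3)) : ℝ) : 𝕜) * RCLike.I
  let C := (Fintype.piFinset fun _ : Fin n × Fin 4 => Finset.range (N + 1)).filter
    fun c => ∑ i, c i ≤ N
  refine ⟨(C.image f).filter fun s => ‖s‖ ≤ 1, ?_, fun s hs => (Finset.mem_filter.1 hs).2, ?_⟩
  · refine (Finset.card_filter_le _ _).trans (Finset.card_image_le.trans
      ((card_sum_le_le _ _).trans (le_of_eq ?_)))
    congr 1
    simp [hN]; ring
  intro x hx
  have hx2 : ∑ i, ‖x i‖ ^ 2 ≤ 1 := by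
    rw [← EuclideanSpace.norm_sq_eq]
    exact pow_le_one₀ (norm_nonneg _) hx
  choose b₀ b₁ hb hb' hb'' using fun i => Real.exists_nat_sub_nat_approx (RCLike.re (x i) / h)
  choose c₀ c₁ hc hc' hc'' using fun i => Real.exists_nat_sub_nat_approx (RCLike.im (x i) / h)
  let c : Fin n × Fin 4 → ℕ := fun q => ![b₀ q.1, b₁ q.1, c₀ q.1, c₁ q.1] q.2
  have hf (i) : f c i = ((h * ((b₀ i : ℝ) - b₁ i) : ℝ) : 𝕜) +
      ((h * ((c₀ i : ℝ) - c₁ i) : ℝ) : 𝕜) * RCLike.I := by simp [f, c]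
  have hsum : ∑ q, c q ≤ N := by
    have h1 : ((∑ q, c q : ℕ) : ℝ) ≤ ∑ i, ‖x i‖ ^ 2 / h ^ 2 := by
      rw [Fintype.sum_prod_type]
      push_cast
      refine Finset.sum_le_sum fun i _ => ?_
      have := hb'' i
      have := hc'' i
      have e : ‖x i‖ ^ 2 / h ^ 2 = (RCLike.re (x i) / h) ^ 2 + (RCLike.im (x i) / h) ^ 2 := by
        rw [← RCLike.normSq_eq_def', RCLike.normSq_apply]; ring
      rw [e]
      simp only [c, Fin.sum_univ_four]
      simp
      linarith
    have h2 : ∑ i, ‖x i‖ ^ 2 / h ^ 2 ≤ N := by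
      rw [← Finset.sum_div, div_le_iff₀ (by positivity), hNh]; exact hx2
    exact_mod_cast h1.trans h2
  have hscale (t u v : ℝ) (huv : |t / h - (u - v)| ≤ 1) : (t - h * (u - v)) ^ 2 ≤ h ^ 2 := by
    have e : t - h * (u - v) = h * (t / h - (u - v)) := by field_simp
    rw [e, mul_pow]
    exact mul_le_of_le_one_right (by positivity) ((sq_le_one_iff_abs_le_one _).2 huv)
  have hscale' (t u v : ℝ) (huv : |u - v| ≤ |t / h|) : (h * (u - v)) ^ 2 ≤ t ^ 2 := by
    have e : t = h * (t / h) := by field_simp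
    rw [e, mul_pow, mul_pow]
    gcongr ?_ * ?_
    exact sq_le_sq.2 huv
  have hnorm (i) : ‖f c i‖ ^ 2 ≤ ‖x i‖ ^ 2 := by
    rw [hf, ← RCLike.normSq_eq_def' (x i), RCLike.normSq_apply, ← sq, ← sq]
    exact (RCLike.norm_ofReal_add_ofReal_mul_I_sq_le _ _).trans
      (add_le_add (hscale' _ _ _ (hb' i)) (hscale' _ _ _ (hc' i)))
  have herr (i) : ‖(x - f c) i‖ ^ 2 ≤ 2 * h ^ 2 := by
    have e : (x - f c) i = ((RCLike.re (x i) - h * ((b₀ i : ℝ) - b₁ i) : ℝ) : 𝕜) +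
        ((RCLike.im (x i) - h * ((c₀ i : ℝ) - c₁ i) : ℝ) : 𝕜) * RCLike.I := by
      rw [PiLp.sub_apply, hf]
      conv_lhs => rw [← RCLike.re_add_im (x i)]
      push_cast; ring
    rw [e]
    have := RCLike.norm_ofReal_add_ofReal_mul_I_sq_le (𝕜 := 𝕜)
      (RCLike.re (x i) - h * ((b₀ i : ℝ) - b₁ i)) (RCLike.im (x i) - h * ((c₀ i : ℝ) - c₁ i))
    linarith [hscale _ _ _ (hb i), hscale _ _ _ (hc i)]
  refine ⟨f c, Finset.mem_filter.2 ⟨Finset.mem_image_of_mem f (Finset.mem_filter.2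
    ⟨Fintype.mem_piFinset.2 fun q => Finset.mem_range.2 (Nat.lt_succ_of_le
      ((Finset.single_le_sum (fun _ _ => Nat.zero_le _) (Finset.mem_univ q)).trans hsum)),
      hsum⟩), ?_⟩, ?_⟩
  · rw [← sq_le_one_iff₀ (norm_nonneg _), EuclideanSpace.norm_sq_eq]
    exact (Finset.sum_le_sum fun i _ => hnorm i).trans hx2
  · refine abs_le_of_sq_le_sq' ?_ (by positivity) |>.2
    rw [EuclideanSpace.norm_sq_eq]
    refine (Finset.sum_le_sum fun i _ => herr i).trans ?_
    rw [Finset.sum_const, Finset.card_univ, Fintype.card_fin, nsmul_eq_mul, hh, div_pow, mul_pow,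
      mul_pow, Real.sq_sqrt hn'.le, div_pow]
    field_simp
    norm_num

/-! ### Multilinear forms on `ℓ_p` and their coefficients -/

/-- The `m`-linear form on `ℓ_p^n` with given coefficients. -/
noncomputable def multilinearOfCoeff {𝕜 : Type*} [RCLike 𝕜] {m n : ℕ} (p : ℝ≥0∞) [Fact (1 ≤ p)]
    (a : (Fin m → Fin n) → 𝕜) : EllPForm 𝕜 m p n :=
  ∑ j, a j • (ContinuousMultilinearMap.mkPiAlgebra 𝕜 (Fin m) 𝕜).compContinuousLinearMap
    fun k => PiLp.proj p (fun _ : Fin n => 𝕜) (j k)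

theorem multilinearOfCoeff_apply {𝕜 : Type*} [RCLike 𝕜] {m n : ℕ} (p : ℝ≥0∞) [Fact (1 ≤ p)]
    (a : (Fin m → Fin n) → 𝕜) (x : Fin m → EllP 𝕜 p n) :
    multilinearOfCoeff p a x = coeffForm a fun k i => x k i := by
  simp [multilinearOfCoeff, coeffForm]

theorem apply_eq_coeffForm {𝕜 : Type*} [RCLike 𝕜] {m n : ℕ} {p : ℝ≥0∞} [Fact (1 ≤ p)]
    (T : EllPForm 𝕜 m p n) (x : Fin m → EllP 𝕜 p n) :
    T x = coeffForm (fun j => T fun k => PiLp.single p (j k) (1 : 𝕜)) fun k i => x k i := by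
  have hx : x = fun k => ∑ i, x k i • (PiLp.single p i (1 : 𝕜) : EllP 𝕜 p n) := by
    ext k i
    simp [Pi.single_apply]
  conv_lhs => rw [hx, T.map_sum]
  exact Finset.sum_congr rfl fun j _ => by rw [T.map_smul_univ, smul_eq_mul, mul_comm]

theorem multilinearOfCoeff_single {𝕜 : Type*} [RCLike 𝕜] {m n : ℕ} (p : ℝ≥0∞) [Fact (1 ≤ p)]
    (a : (Fin m → Fin n) → 𝕜) (j : Fin m → Fin n) :
    multilinearOfCoeff p a (fun k => PiLp.single p (j k) (1 : 𝕜)) = a j := by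
  rw [multilinearOfCoeff_apply, coeffForm, Finset.sum_eq_single j]
  · simp
  · intro i _ hi
    obtain ⟨k, hk⟩ := Function.ne_iff.1 hi
    rw [Finset.prod_eq_zero (Finset.mem_univ k), mul_zero]
    simp [hk]
  · simp

theorem opNorm_le_of_unit_ball {𝕜 : Type*} [RCLike 𝕜] {m n : ℕ} {p : ℝ≥0∞} [Fact (1 ≤ p)]
    (T : EllPForm 𝕜 m p n) {C : ℝ} (hC : 0 ≤ C)
    (h : ∀ u : Fin m → EllP 𝕜 p n, (∀ k, ‖u k‖ ≤ 1) → ‖T u‖ ≤ C) : ‖T‖ ≤ C := by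
  refine T.opNorm_le_bound hC fun x => ?_
  by_cases hx : ∃ k, x k = 0
  · obtain ⟨k, hk⟩ := hx
    rw [T.map_coord_zero k hk, norm_zero]
    positivity
  · push Not at hx
    have hu : x = fun k => (‖x k‖ : 𝕜) • ((‖x k‖ : 𝕜)⁻¹ • x k) := by
      ext1 k
      rw [smul_smul, mul_inv_cancel₀ (by simpa using hx k), one_smul]
    conv_lhs => rw [hu, T.map_smul_univ]
    rw [norm_smul, norm_prod, mul_comm]
    simp only [RCLike.norm_ofReal, abs_norm]
    refine mul_le_mul_of_nonneg_right (h _ fun k => le_of_eq ?_) (by positivity)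
    rw [norm_smul, norm_inv, RCLike.norm_ofReal, abs_norm,
      inv_mul_cancel₀ (norm_ne_zero_iff.2 (hx k))]

/-! ### The Kahane–Salem–Zygmund inequality -/

/-- The Kahane–Salem–Zygmund inequality: some form with all coefficients `±1` has norm of order
`√n` on `ℓ₂ⁿ`, the least possible order. The signs are chosen to make the form small on a finite
net, from which the bound passes to the whole ball. -/
theorem exists_norm_multilinearOfCoeff_le (𝕜 : Type*) [RCLike 𝕜] (m : ℕ) (hm : 0 < m) :
    ∃ B : ℝ, 0 < B ∧ ∀ n : ℕ, 0 < n → ∃ a : (Fin m → Fin n) → 𝕜, (∀ j, ‖a j‖ = 1) ∧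
      ‖multilinearOfCoeff 2 a‖ ≤ B * √n := by
  set Q : ℕ := (4 * (2 * m) ^ 2 + 4) * m + 2 with hQ
  refine ⟨8 * √Q, by positivity, fun n hn => ?_⟩
  have hm' : (0 : ℝ) < m := by exact_mod_cast hm
  -- `m` errors of size `1 / (2m)` lose only half of the norm when passing from the net to the ball
  obtain ⟨S, hScard, hS1, hSnet⟩ := exists_net 𝕜 n (2 * m) hn (by omega)
  set t : ℝ := √Q * √n with ht
  have ht0 : 0 < t := by positivity
  let P (s : Fin m → S) (j : Fin m → Fin n) : 𝕜 := ∏ k, (s k : EllP 𝕜 2 n) (j k)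
  let A : (Fin m → S) × Bool → (Fin m → Fin n) → ℝ := fun γ j =>
    if γ.2 then RCLike.re (P γ.1 j) else RCLike.im (P γ.1 j)
  have hP (s : Fin m → S) : ∑ j, ‖P s j‖ ^ 2 ≤ 1 := by
    calc ∑ j, ‖P s j‖ ^ 2 = ∏ k, ‖(s k : EllP 𝕜 2 n)‖ ^ 2 := by
          simp only [P, norm_prod, ← Finset.prod_pow, EuclideanSpace.norm_sq_eq]
          rw [Finset.prod_univ_sum, Fintype.piFinset_univ]
      _ ≤ 1 := Finset.prod_le_one (fun _ _ => by positivity)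
          fun k _ => pow_le_one₀ (norm_nonneg _) (hS1 _ (s k).2)
  have hA (γ) : ∑ j, A γ j ^ 2 ≤ 1 := by
    refine (Finset.sum_le_sum fun j _ => ?_).trans (hP γ.1)
    rw [← RCLike.normSq_eq_def', RCLike.normSq_apply]
    simp only [A]
    split_ifs
    · nlinarith [mul_self_nonneg (RCLike.im (P γ.1 j))]
    · nlinarith [mul_self_nonneg (RCLike.re (P γ.1 j))]
  have hcard : 2 * (Fintype.card ((Fin m → S) × Bool) : ℝ) ≤ Real.exp (t ^ 2) := by
    have h1 : 2 * Fintype.card ((Fin m → S) × Bool) ≤ 2 ^ (Q * n) := by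
      rw [Fintype.card_prod, Fintype.card_fun, Fintype.card_fin, Fintype.card_coe,
        Fintype.card_bool]
      calc 2 * (S.card ^ m * 2) ≤ 2 * ((2 ^ ((4 * (2 * m) ^ 2 + 4) * n)) ^ m * 2) := by gcongr
        _ = 2 ^ ((4 * (2 * m) ^ 2 + 4) * m * n + 2) := by
          rw [← pow_mul, pow_add, mul_right_comm _ n m]; ring
        _ ≤ 2 ^ (Q * n) := by
          refine Nat.pow_le_pow_right two_pos ?_
          rw [hQ, Nat.add_mul _ 2 n]
          exact Nat.add_le_add_left (by omega) _
    have h2 : t ^ 2 = ((Q * n : ℕ) : ℝ) := by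
      rw [ht, mul_pow, Real.sq_sqrt (by positivity), Real.sq_sqrt (by positivity)]; push_cast; rfl
    calc 2 * (Fintype.card ((Fin m → S) × Bool) : ℝ) ≤ 2 ^ (Q * n) := by exact_mod_cast h1
      _ ≤ (Real.exp 1) ^ (Q * n) := by
          gcongr
          linarith [Real.add_one_le_exp 1]
      _ = Real.exp (t ^ 2) := by rw [h2, Real.exp_one_pow]
  obtain ⟨ε, hε⟩ := exists_signs_abs_sum_le A hA t ht0 hcard
  set a : (Fin m → Fin n) → 𝕜 := fun j => ((ε j : ℤ) : 𝕜) with ha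
  refine ⟨a, fun j => ?_, ?_⟩
  · rcases Int.units_eq_one_or (ε j) with h | h <;> simp [ha, h]
  set T := multilinearOfCoeff 2 a with hT
  have hTs (s : Fin m → S) : ‖T fun k => (s k : EllP 𝕜 2 n)‖ ≤ 4 * t := by
    have e : (T fun k => (s k : EllP 𝕜 2 n)) = ∑ j, (((ε j : ℤ) : ℝ) : 𝕜) * P s j := by
      rw [hT, multilinearOfCoeff_apply, coeffForm]
      simp [ha, P]
    have hre := hε (s, true)
    have him := hε (s, false)
    refine (RCLike.norm_le_abs_re_add_abs_im _).trans ?_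
    rw [e, map_sum, map_sum]
    simp only [RCLike.re_ofReal_mul, RCLike.im_ofReal_mul]
    simp only [A, if_true, Bool.false_eq_true, if_false] at hre him
    linarith
  have hle : ‖T‖ ≤ 4 * t + ‖T‖ / 2 := by
    refine opNorm_le_of_unit_ball T (by positivity) fun u hu => ?_
    choose s hsS hs using fun k => hSnet (u k) (hu k)
    have h1 := T.norm_image_sub_le u s
    have h2 : max ‖u‖ ‖s‖ ≤ 1 := max_le ((pi_norm_le_iff_of_nonneg zero_le_one).2 hu)
      ((pi_norm_le_iff_of_nonneg zero_le_one).2 fun k => hS1 _ (hsS k))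
    have h3 : ‖u - s‖ ≤ 1 / (2 * m : ℕ) := (pi_norm_le_iff_of_nonneg (by positivity)).2 hs
    have h4 : ‖T u - T s‖ ≤ ‖T‖ / 2 := by
      refine h1.trans ?_
      calc _ ≤ ‖T‖ * (Fintype.card (Fin m) : ℝ) * 1 ^ (Fintype.card (Fin m) - 1) *
            (1 / (2 * m : ℕ)) := by gcongr
        _ = ‖T‖ / 2 := by rw [Fintype.card_fin, one_pow]; push_cast; field_simp
    have h5 := hTs fun k => ⟨s k, hsS k⟩
    calc ‖T u‖ = ‖T s + (T u - T s)‖ := by rw [add_sub_cancel]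
      _ ≤ ‖T s‖ + ‖T u - T s‖ := norm_add_le _ _
      _ ≤ _ := add_le_add h5 h4
  rw [ht] at hle
  linarith

/-! ### Comparison of `ℓ_p`-norms -/

theorem rpow_sum_rpow_le_card_rpow_mul {ι : Type*} [Fintype ι] [Nonempty ι] (z : ι → ℝ)
    (hz : ∀ i, 0 ≤ z i) {p q : ℝ} (hp : 0 < p) (hpq : p ≤ q) :
    (∑ i, z i ^ p) ^ (1 / p) ≤
      (Fintype.card ι : ℝ) ^ (1 / p - 1 / q) * (∑ i, z i ^ q) ^ (1 / q) := by
  have hq : 0 < q := hp.trans_le hpq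
  have h0 : 0 ≤ ∑ i, z i ^ p := Finset.sum_nonneg fun i _ => Real.rpow_nonneg (hz i) _
  have h0' : 0 ≤ ∑ i, z i ^ q := Finset.sum_nonneg fun i _ => Real.rpow_nonneg (hz i) _
  have h := Real.rpow_sum_le_const_mul_sum_rpow_of_nonneg Finset.univ (f := fun i => z i ^ p)
    (p := q / p) ((one_le_div hp).2 hpq) fun i _ => Real.rpow_nonneg (hz i) _
  have e (i) : (z i ^ p) ^ (q / p) = z i ^ q := by
    rw [← Real.rpow_mul (hz i)]; congr 1; field_simp
  simp only [e] at h
  have h2 := Real.rpow_le_rpow (Real.rpow_nonneg h0 _) h (by positivity : 0 ≤ 1 / q)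
  rw [← Real.rpow_mul h0, Real.mul_rpow (by positivity) h0', ← Real.rpow_mul (by positivity)] at h2
  convert h2 using 2
  · field_simp
  · rw [Finset.card_univ]; congr 1; field_simp

theorem norm_toLp_le_rpow_mul {𝕜 : Type*} [RCLike 𝕜] {p q : ℝ≥0∞} [Fact (1 ≤ p)] [Fact (1 ≤ q)]
    (hq : q ≠ ⊤) (hpq : p ≤ q) {n : ℕ} (hn : 0 < n) (z : Fin n → 𝕜) :
    ‖(WithLp.toLp p z : EllP 𝕜 p n)‖ ≤
      (n : ℝ) ^ (1 / p.toReal - 1 / q.toReal) * ‖(WithLp.toLp q z : EllP 𝕜 q n)‖ := by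
  have hp : p ≠ ⊤ := (hpq.trans_lt hq.lt_top).ne
  have hp0 : 0 < p.toReal := ENNReal.toReal_pos (zero_lt_one.trans_le Fact.out).ne' hp
  have hq0 : 0 < q.toReal := ENNReal.toReal_pos (zero_lt_one.trans_le Fact.out).ne' hq
  have : Nonempty (Fin n) := ⟨⟨0, hn⟩⟩
  rw [PiLp.norm_eq_sum hp0, PiLp.norm_eq_sum hq0]
  simpa using rpow_sum_rpow_le_card_rpow_mul (fun i => ‖z i‖) (fun _ => norm_nonneg _) hp0
    (ENNReal.toReal_mono hq hpq)

theorem norm_toLp_two_le {𝕜 : Type*} [RCLike 𝕜] {p : ℝ≥0∞} [Fact (1 ≤ p)] (hp : p ≤ 2) {n : ℕ}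
    (x : EllP 𝕜 p n) : ‖(WithLp.toLp 2 x.ofLp : EllP 𝕜 2 n)‖ ≤ ‖x‖ := by
  have hpt : p ≠ ⊤ := (hp.trans_lt (by simp)).ne
  have hp0 : 0 < p.toReal := ENNReal.toReal_pos (zero_lt_one.trans_le Fact.out).ne' hpt
  have hp2 : p.toReal ≤ 2 := by simpa using ENNReal.toReal_mono (by simp) hp
  have hi (i) : ‖x i‖ ≤ ‖x‖ := PiLp.norm_apply_le x i
  have hx : ∑ i, ‖x i‖ ^ p.toReal = ‖x‖ ^ p.toReal := by
    rw [PiLp.norm_eq_sum hp0, ← Real.rpow_mul (Finset.sum_nonneg fun _ _ => by positivity),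
      one_div_mul_cancel hp0.ne', Real.rpow_one]
  refine abs_le_of_sq_le_sq' ?_ (norm_nonneg _) |>.2
  rw [EuclideanSpace.norm_sq_eq]
  have hsplit (y : ℝ) (hy : 0 ≤ y) : y ^ 2 = y ^ p.toReal * y ^ (2 - p.toReal) := by
    rw [← Real.rpow_add_of_nonneg hy hp0.le (by linarith), add_sub_cancel, Real.rpow_two]
  calc ∑ i, ‖x i‖ ^ 2 ≤ ∑ i, ‖x i‖ ^ p.toReal * ‖x‖ ^ (2 - p.toReal) := by
        refine Finset.sum_le_sum fun i _ => ?_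
        rw [hsplit _ (norm_nonneg _)]
        exact mul_le_mul_of_nonneg_left
          (Real.rpow_le_rpow (norm_nonneg _) (hi i) (by linarith)) (by positivity)
    _ = ‖x‖ ^ 2 := by rw [← Finset.sum_mul, hx, ← hsplit _ (norm_nonneg _)]

/-! ### Upper bounds for the coefficients -/

theorem norm_apply_single_le {𝕜 : Type*} [RCLike 𝕜] {m n : ℕ} {p : ℝ≥0∞} [Fact (1 ≤ p)]
    (T : EllPForm 𝕜 m p n) (j : Fin m → Fin n) :
    ‖T fun k => PiLp.single p (j k) (1 : 𝕜)‖ ≤ ‖T‖ := by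
  simpa using T.le_opNorm fun k => PiLp.single p (j k) (1 : 𝕜)

/-- For exponents `r ≥ 2` only the square sum of the coefficients matters, since each coefficient
is bounded by the norm. -/
theorem coeffNorm_le_of_sum_sq_le {𝕜 : Type*} [RCLike 𝕜] {m n : ℕ} {p : ℝ≥0∞} [Fact (1 ≤ p)]
    (T : EllPForm 𝕜 m p n) {r C : ℝ} (hr : 2 < r) (hC : 0 ≤ C)
    (h : ∑ j : Fin m → Fin n, ‖T fun k => PiLp.single p (j k) (1 : 𝕜)‖ ^ 2 ≤ C * ‖T‖ ^ 2) :
    coeffNorm r T ≤ C ^ (1 / r) * ‖T‖ := by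
  have hr0 : 0 < r := by linarith
  have hsplit (y : ℝ) (hy : 0 ≤ y) : y ^ r = y ^ 2 * y ^ (r - 2) := by
    rw [← Real.rpow_two, ← Real.rpow_add_of_nonneg hy zero_le_two (by linarith), add_sub_cancel]
  have h1 : ∑ j : Fin m → Fin n, ‖T fun k => PiLp.single p (j k) (1 : 𝕜)‖ ^ r ≤ C * ‖T‖ ^ r := by
    calc _ ≤ ∑ j : Fin m → Fin n,
          ‖T fun k => PiLp.single p (j k) (1 : 𝕜)‖ ^ 2 * ‖T‖ ^ (r - 2) := by
          refine Finset.sum_le_sum fun j _ => ?_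
          rw [hsplit _ (norm_nonneg _)]
          exact mul_le_mul_of_nonneg_left (Real.rpow_le_rpow (norm_nonneg _)
            (norm_apply_single_le T j) (by linarith)) (by positivity)
      _ ≤ C * ‖T‖ ^ 2 * ‖T‖ ^ (r - 2) := by rw [← Finset.sum_mul]; gcongr
      _ = C * ‖T‖ ^ r := by rw [hsplit ‖T‖ (norm_nonneg _)]; ring
  calc coeffNorm r T ≤ (C * ‖T‖ ^ r) ^ (1 / r) :=
        Real.rpow_le_rpow (Finset.sum_nonneg fun _ _ => by positivity) h1 (by positivity)
    _ = C ^ (1 / r) * ‖T‖ := by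
        rw [Real.mul_rpow hC (by positivity), ← Real.rpow_mul (norm_nonneg _),
          mul_one_div_cancel hr0.ne', Real.rpow_one]

/-- For `p ≤ 2` each row of coefficients has `ℓ₂`-norm at most `n ^ (1 / p - 1 / 2) ‖T‖`, as one
sees by testing the form on the conjugate of the row. -/
theorem sum_sq_row_le {𝕜 : Type*} [RCLike 𝕜] {m n : ℕ} {p : ℝ≥0∞} [Fact (1 ≤ p)] (hp : p ≤ 2)
    (hn : 0 < n) (T : EllPForm 𝕜 (m + 1) p n) (g : Fin m → Fin n) :
    ∑ i, ‖T fun k => PiLp.single p ((Fin.cons i g : Fin (m + 1) → Fin n) k) (1 : 𝕜)‖ ^ 2 ≤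
      ((n : ℝ) ^ (1 / p.toReal - 1 / 2) * ‖T‖) ^ 2 := by
  set c : Fin n → 𝕜 :=
    fun i => T fun k => PiLp.single p ((Fin.cons i g : Fin (m + 1) → Fin n) k) (1 : 𝕜) with hc
  set w : Fin m → EllP 𝕜 p n := fun k => PiLp.single p (g k) (1 : 𝕜) with hw
  set x : EllP 𝕜 p n := WithLp.toLp p fun i => star (c i) with hx
  have hcons (i) : c i = T.curryLeft (PiLp.single p i (1 : 𝕜)) w := by
    rw [ContinuousMultilinearMap.curryLeft_apply]
    refine congrArg T (funext fun k => ?_)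
    refine Fin.cases ?_ (fun k => ?_) k <;> simp [hw]
  have hval : T (Fin.cons x w) = ((∑ i, ‖c i‖ ^ 2 : ℝ) : 𝕜) := by
    have hxs : x = ∑ i, x i • (PiLp.single p i (1 : 𝕜) : EllP 𝕜 p n) := by
      ext i
      simp [Pi.single_apply]
    rw [← ContinuousMultilinearMap.curryLeft_apply, hxs, map_sum, sum_apply]
    push_cast
    refine Finset.sum_congr rfl fun i _ => ?_
    rw [map_smul, smul_apply, ← hcons, smul_eq_mul, hx]
    exact RCLike.conj_mul (c i)
  set S := ∑ i, ‖c i‖ ^ 2 with hS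
  have hS0 : 0 ≤ S := Finset.sum_nonneg fun _ _ => by positivity
  have h1 : S ≤ ‖T‖ * ‖x‖ := by
    have h := ContinuousMultilinearMap.norm_map_cons_le T x w
    rw [hval, RCLike.norm_ofReal, abs_of_nonneg hS0] at h
    simpa [hw] using h
  have h2 : ‖x‖ ≤ (n : ℝ) ^ (1 / p.toReal - 1 / 2) * √S := by
    have h := norm_toLp_le_rpow_mul (q := 2) (by simp) hp hn fun i => star (c i)
    rw [EuclideanSpace.norm_eq] at h
    simpa [hx, hS] using h
  rcases hS0.eq_or_lt with h0 | hpos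
  · rw [← h0]; positivity
  have h3 : √S ≤ (n : ℝ) ^ (1 / p.toReal - 1 / 2) * ‖T‖ := by
    refine le_of_mul_le_mul_right ?_ (Real.sqrt_pos.2 hpos)
    rw [Real.mul_self_sqrt hS0]
    calc S ≤ ‖T‖ * ‖x‖ := h1
      _ ≤ ‖T‖ * ((n : ℝ) ^ (1 / p.toReal - 1 / 2) * √S) := by gcongr
      _ = _ := by ring
  calc S = √S ^ 2 := (Real.sq_sqrt hS0).symm
    _ ≤ _ := by gcongr

theorem sum_sq_le_of_le_two {𝕜 : Type*} [RCLike 𝕜] {m n : ℕ} {p : ℝ≥0∞} [Fact (1 ≤ p)]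
    (hp : p ≤ 2) (hm : 0 < m) (hn : 0 < n) (T : EllPForm 𝕜 m p n) :
    ∑ j : Fin m → Fin n, ‖T fun k => PiLp.single p (j k) (1 : 𝕜)‖ ^ 2 ≤
      (n : ℝ) ^ ((m : ℝ) - 2 + 2 / p.toReal) * ‖T‖ ^ 2 := by
  obtain ⟨m, rfl⟩ : ∃ l, m = l + 1 := ⟨m - 1, by omega⟩
  have hn' : (0 : ℝ) < n := by exact_mod_cast hn
  rw [Fin.sum_pi_succ, Finset.sum_comm]
  refine (Finset.sum_le_sum fun g _ => sum_sq_row_le hp hn T g).trans (le_of_eq ?_)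
  rw [Finset.sum_const, Finset.card_univ, nsmul_eq_mul, mul_pow, ← mul_assoc]
  congr 1
  rw [Fintype.card_fun, Fintype.card_fin, Fintype.card_fin, Nat.cast_pow, ← Real.rpow_natCast,
    ← Real.rpow_natCast, ← Real.rpow_mul hn'.le, ← Real.rpow_add hn']
  congr 1
  push_cast; ring

/-- For `2 ≤ p ≤ 2m` the Hardy–Littlewood inequality on `ℓ_{2m}` is transported to `ℓ_p` by
comparing the two norms. -/
theorem sum_sq_le_of_le_two_mul {𝕜 : Type*} [RCLike 𝕜] {m n : ℕ} {p : ℝ≥0∞} [Fact (1 ≤ p)]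
    (hp : p ≤ (2 * m : ℕ)) (hm : 0 < m) (hn : 0 < n) (T : EllPForm 𝕜 m p n) :
    ∑ j : Fin m → Fin n, ‖T fun k => PiLp.single p (j k) (1 : 𝕜)‖ ^ 2 ≤
      4 ^ m * (n : ℝ) ^ (2 * m / p.toReal - 1) * ‖T‖ ^ 2 := by
  have hn' : (0 : ℝ) < n := by exact_mod_cast hn
  have hm' : (0 : ℝ) < m := by exact_mod_cast hm
  have : Fact (1 ≤ ((2 * m : ℕ) : ℝ≥0∞)) := ⟨by exact_mod_cast (by omega : 1 ≤ 2 * m)⟩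
  refine (sum_norm_sq_le_of_coeffForm_le hm _
    (‖T‖ * ((n : ℝ) ^ (1 / p.toReal - 1 / (2 * m))) ^ m) fun x hx => ?_).trans (le_of_eq ?_)
  · have h1 := apply_eq_coeffForm T fun k => WithLp.toLp p (x k)
    simp only at h1
    rw [← h1]
    refine (T.le_opNorm _).trans ?_
    gcongr
    refine (Finset.prod_le_prod (fun _ _ => norm_nonneg _) fun k _ => ?_).trans_eq
      (by rw [Finset.prod_const, Finset.card_univ, Fintype.card_fin])
    refine (norm_toLp_le_rpow_mul (q := (2 * m : ℕ)) (ENNReal.natCast_ne_top _) hp hn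
      (x k)).trans ?_
    rw [ENNReal.toReal_natCast]
    push_cast
    refine mul_le_of_le_one_right (by positivity) ?_
    rw [PiLp.norm_eq_sum (by rw [ENNReal.toReal_natCast]; positivity)]
    refine Real.rpow_le_one (Finset.sum_nonneg fun _ _ => by positivity) ?_ (by positivity)
    simpa only [ENNReal.toReal_natCast, Real.rpow_natCast] using hx k
  · rw [mul_pow, ← pow_mul, ← Real.rpow_natCast _ (m * 2), ← Real.rpow_mul hn'.le,
      mul_comm (‖T‖ ^ 2), ← mul_assoc]
    congr 3
    push_cast
    field_simp

/-! ### Lower bounds for admissible exponents -/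

/-- Testing the inequality on random forms: if `ℓ_p ⊆ ℓ₂` with norm at most `n ^ σ`, an admissible
exponent is at least `m / r - 1 / 2 - m σ`. -/
theorem AdmissibleExponent.le {𝕜 : Type*} [RCLike 𝕜] {m : ℕ} (hm : 0 < m) {r : ℝ}
    {p : ℝ≥0∞} [Fact (1 ≤ p)] {s σ : ℝ} (hs : AdmissibleExponent 𝕜 m r p s)
    (hσ : ∀ n : ℕ, 0 < n → ∀ x : EllP 𝕜 p n,
      ‖(WithLp.toLp 2 x.ofLp : EllP 𝕜 2 n)‖ ≤ (n : ℝ) ^ σ * ‖x‖) :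
    m / r - 1 / 2 - m * σ ≤ s := by
  obtain ⟨D, hD, hbound⟩ := hs
  obtain ⟨B, hB, hex⟩ := exists_norm_multilinearOfCoeff_le 𝕜 m hm
  by_contra! hlt
  set δ := m / r - 1 / 2 - m * σ - s with hδ
  have hle (n : ℕ) (hn : 0 < n) : (n : ℝ) ^ δ ≤ D * B := by
    have hn' : (0 : ℝ) < n := by exact_mod_cast hn
    obtain ⟨a, ha, hT⟩ := hex n hn
    have hnorm : ‖multilinearOfCoeff p a‖ ≤ B * √n * ((n : ℝ) ^ σ) ^ m := by
      refine ContinuousMultilinearMap.opNorm_le_bound (by positivity) fun x => ?_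
      have h1 : multilinearOfCoeff p a x =
          multilinearOfCoeff 2 a fun k => WithLp.toLp 2 (x k).ofLp := by
        rw [multilinearOfCoeff_apply, multilinearOfCoeff_apply]
      rw [h1]
      calc _ ≤ ‖multilinearOfCoeff 2 a‖ * ∏ k, ‖(WithLp.toLp 2 (x k).ofLp : EllP 𝕜 2 n)‖ :=
            ContinuousMultilinearMap.le_opNorm _ _
        _ ≤ B * √n * ∏ k, ((n : ℝ) ^ σ * ‖x k‖) := by
            gcongr with k
            exact hσ n hn (x k)
        _ = _ := by simp [Finset.prod_mul_distrib, mul_assoc]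
    have hcoeff : coeffNorm r (multilinearOfCoeff p a) = (n : ℝ) ^ (m / r) := by
      simp only [coeffNorm, multilinearOfCoeff_single, ha, Real.one_rpow, Finset.sum_const,
        Finset.card_univ, nsmul_eq_mul, mul_one, Fintype.card_fun, Fintype.card_fin]
      rw [Nat.cast_pow, ← Real.rpow_natCast, ← Real.rpow_mul hn'.le, mul_one_div]
    have h := hbound n hn (multilinearOfCoeff p a)
    rw [hcoeff] at h
    have h2 : (n : ℝ) ^ (m / r) ≤ D * B * (n : ℝ) ^ (s + 1 / 2 + m * σ) := by
      calc (n : ℝ) ^ (m / r) ≤ D * (n : ℝ) ^ s * (B * √n * ((n : ℝ) ^ σ) ^ m) := by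
            refine h.trans ?_; gcongr
        _ = _ := by
            rw [Real.rpow_add hn', Real.rpow_add hn', ← Real.sqrt_eq_rpow, mul_comm (m : ℝ) σ,
              Real.rpow_mul hn'.le, Real.rpow_natCast]
            ring
    have e : (m : ℝ) / r = δ + (s + 1 / 2 + m * σ) := by rw [hδ]; ring
    rw [e, Real.rpow_add hn'] at h2
    exact le_of_mul_le_mul_right h2 (by positivity)
  have ht := (tendsto_rpow_atTop (sub_pos.2 hlt)).comp tendsto_natCast_atTop_atTop
  obtain ⟨n, hn, hn0⟩ := ((ht.eventually_gt_atTop (D * B)).and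
    (Filter.eventually_gt_atTop 0)).exists
  exact absurd (hle n hn0) (not_le.2 hn)

/-! ### The optimal exponents -/

theorem proposition2 (𝕜 : Type*) [RCLike 𝕜] (m : ℕ) (hm : 2 ≤ m)
    (r : ℝ) (p : ℝ≥0∞) [Fact (1 ≤ p)] :
    -- (a): `(r, p) ∈ [1, 2] × [1, 2)`
    (1 ≤ r → r ≤ 2 → p < 2 →
      (∃ D : ℝ, 0 < D ∧ HLBound 𝕜 m r p D
        ((2 * m * r + 2 * m * p.toReal - m * p.toReal * r - p.toReal * r) / (2 * p.toReal * r))) ∧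
      (∀ s : ℝ, AdmissibleExponent 𝕜 m r p s → (2 * m - r) / (2 * r) ≤ s)) ∧
    -- (b): `(r, p) ∈ (2, ∞) × [1, m]`
    (2 < r → p ≤ (m : ℝ≥0∞) →
      (2 < p → ∃ D : ℝ, 0 < D ∧ ∀ ε : ℝ, 0 < ε →
        HLBound 𝕜 m r p D ((2 * m - p.toReal + ε) / (p.toReal * r))) ∧
      (p = 2 → ∃ D : ℝ, 0 < D ∧ HLBound 𝕜 m r p D ((2 * m - p.toReal) / (p.toReal * r))) ∧
      (2 ≤ p → ∀ s : ℝ, AdmissibleExponent 𝕜 m r p s →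
        (2 * m * r + 2 * m * p.toReal - m * p.toReal * r - p.toReal * r) /
          (2 * p.toReal * r) ≤ s) ∧
      (p ≤ 2 → ∀ s : ℝ, AdmissibleExponent 𝕜 m r p s → (2 * m - r) / (2 * r) ≤ s)) := by
  have hm0 : 0 < m := by omega
  have hm2 : (2 : ℝ) ≤ m := by exact_mod_cast hm
  have hp1 : p ≠ ⊤ → 1 ≤ p.toReal := fun h => by
    simpa using ENNReal.toReal_mono h (Fact.out : 1 ≤ p)
  have hlow (hr : 0 < r) (hp : p ≤ 2) (s : ℝ) (hs : AdmissibleExponent 𝕜 m r p s) :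
      (2 * m - r) / (2 * r) ≤ s := by
    have := hs.le (σ := 0) hm0 fun n _ x => by simpa using norm_toLp_two_le hp x
    refine le_trans (le_of_eq ?_) this
    field_simp
    ring
  refine ⟨fun hr1 hr2 hp => ⟨⟨1, one_pos, fun n hn T => ?_⟩, hlow (by linarith) hp.le⟩,
    fun hr hpm => ⟨fun hp2 => ?_, fun hp2 => ?_, fun hp2 s hs => ?_, hlow (by linarith)⟩⟩
  · have hn1 : (1 : ℝ) ≤ n := by exact_mod_cast hn
    have hn' : (0 : ℝ) < n := by linarith
    have hr0 : 0 < r := by linarith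
    have : Nonempty (Fin n) := ⟨⟨0, hn⟩⟩
    have hp1' := hp1 (hp.trans (by simp)).ne
    have hp2' : p.toReal ≤ 2 := by simpa using ENNReal.toReal_mono (by simp) hp.le
    have hp0 : 0 < p.toReal := by linarith
    have h1 := rpow_sum_rpow_le_card_rpow_mul
      (fun j : Fin m → Fin n => ‖T fun k => PiLp.single p (j k) (1 : 𝕜)‖)
      (fun _ => norm_nonneg _) hr0 hr2
    simp only [Real.rpow_two] at h1
    have h2 := sum_sq_le_of_le_two hp.le hm0 hn T
    have h3 := Real.rpow_le_rpow (Finset.sum_nonneg fun _ _ => by positivity) h2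
      (by norm_num : (0 : ℝ) ≤ 1 / 2)
    rw [Real.mul_rpow (by positivity) (by positivity), ← Real.rpow_mul hn'.le,
      ← Real.sqrt_eq_rpow (‖T‖ ^ 2), Real.sqrt_sq (norm_nonneg _)] at h3
    have h4 := h1.trans (mul_le_mul_of_nonneg_left h3 (by positivity))
    refine h4.trans ?_
    rw [one_mul, ← mul_assoc]
    gcongr
    rw [Fintype.card_fun, Fintype.card_fin, Fintype.card_fin, Nat.cast_pow, ← Real.rpow_natCast,
      ← Real.rpow_mul hn'.le, ← Real.rpow_add hn']
    refine Real.rpow_le_rpow_of_exponent_le hn1 ?_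
    have e : (2 * m * r + 2 * m * p.toReal - m * p.toReal * r - p.toReal * r) /
        (2 * p.toReal * r) - (m * (1 / r - 1 / 2) + (m - 2 + 2 / p.toReal) * (1 / 2)) =
        (m - 1) * (2 - p.toReal) / (2 * p.toReal) := by
      field_simp
      ring
    have h5 : 0 ≤ (m - 1) * (2 - p.toReal) / (2 * p.toReal) :=
      div_nonneg (mul_nonneg (by linarith) (by linarith)) (by linarith)
    linarith
  · have hpt : p ≠ ⊤ := (hpm.trans_lt (by simp)).ne
    have hp0 : 0 < p.toReal := zero_lt_one.trans_le (hp1 hpt)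
    have hr0 : 0 < r := by linarith
    refine ⟨(4 ^ m) ^ (1 / r), by positivity, fun ε hε n hn T => ?_⟩
    have hn1 : (1 : ℝ) ≤ n := by exact_mod_cast hn
    have hp' : p ≤ (2 * m : ℕ) := hpm.trans (by exact_mod_cast (by omega : m ≤ 2 * m))
    refine (coeffNorm_le_of_sum_sq_le T hr (by positivity)
      (sum_sq_le_of_le_two_mul hp' hm0 hn T)).trans ?_
    rw [Real.mul_rpow (by positivity) (by positivity), ← Real.rpow_mul (by positivity)]
    gcongr ?_ * ?_ * _
    refine Real.rpow_le_rpow_of_exponent_le hn1 ?_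
    have e : (2 * m / p.toReal - 1) * (1 / r) = (2 * m - p.toReal) / (p.toReal * r) := by
      field_simp
    rw [e]
    gcongr
    linarith
  · subst hp2
    refine ⟨1, one_pos, fun n hn T => ?_⟩
    refine (coeffNorm_le_of_sum_sq_le T hr (by positivity)
      (sum_sq_le_of_le_two le_rfl hm0 hn T)).trans (le_of_eq ?_)
    rw [← Real.rpow_mul (by positivity), one_mul]
    congr 2
    rw [ENNReal.toReal_ofNat]
    field_simp
    ring
  · have hpt : p ≠ ⊤ := (hpm.trans_lt (by simp)).ne
    have hp0 : 0 < p.toReal := zero_lt_one.trans_le (hp1 hpt)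
    have := hs.le (σ := 1 / 2 - 1 / p.toReal) hm0 fun n hn x => by
      simpa using norm_toLp_le_rpow_mul hpt hp2 hn x.ofLp
    refine le_trans (le_of_eq ?_) this
    field_simp
    ring
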